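/- Let $\Bbbk$ be a field of characteristic $p\ge 3$. A Poisson algebra over $\Bbbk$ is a commutative associative unital $\Bbbk$-algebra $A$ with a $\Bbbk$-bilinear Lie bracket $\{-,-\}$ satisfying $\{xy,z\}=x\{y,z\}+y\{x,z\}$; write $\mathrm{ad}_x=\{x,-\}$. For $x,y\in A$ put $$\Lambda_p(x,y)=\sum_{i=1}^{p-1}\frac{s_i(x,y)}{i},$$ where $s_i(x,y)$ is the coefficient of $t^{i-1}$ in the formal expression $\mathrm{ad}_{tx+y}^{\,p-1}(x)$, and $$\Phi_p(x,y)=(x^p+y^p)\Lambda_p(x,y)-\tfrac12\bigl(\Lambda_p(x^2,y^2)+\Lambda_p(x^2+y^2,2xy)\bigr).$$ A Poisson algebra $A$ with a map $x\mapsto x^{\{p\}}$ from $A$ to $A$ is weakly restricted if $(A,\{-,-\},(-)^{\{p\}})$ is a restricted Lie algebra, that is, for all $x,y\in A$ and $\lambda\in\Bbbk$: $\mathrm{ad}_x^p=\mathrm{ad}_{x^{\{p\}}}$, $(\lambda x)^{\{p\}}=\lambda^p x^{\{p\}}$ and $(x+y)^{\{p\}}=x^{\{p\}}+y^{\{p\}}+\Lambda_p(x,y)$.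 It is restricted if moreover $(x^2)^{\{p\}}=2x^p x^{\{p\}}$ for all $x\in A$. Theorem 4.7. Let $A$ be a weakly restricted Poisson algebra over $\Bbbk$ with $p$-map $(-)^{\{p\}}$, and let $\mathbf b=\{b_i\}_{i\in S}$ be a $\Bbbk$-basis of $A$. If $$(xy)^{\{p\}}=x^p y^{\{p\}}+y^p x^{\{p\}}+\Phi_p(x,y)$$ holds for all $x,y\in\mathbf b$ (including $x=y$), then $A$, with the same $p$-map, is a restricted Poisson algebra. -/

import Mathlib

open Polynomial

noncomputable section

section RestrictedLie

variable {k L : Type*} [Field k] [LieRing L] [LieAlgebra k L]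

/-- `s_i(x, y)`: the coefficient of `t ^ (i - 1)` in the formal expression
`(ad (t x + y)) ^ (p - 1) (x)`. The polynomial `(t ad x + ad y) ^ (p - 1)` is formed in
`End(L)[t]`, where `t` commutes with the coefficients; its coefficient is then applied to `x`. -/
def jacobsonCoeff (k : Type*) {L : Type*} [Field k] [LieRing L] [LieAlgebra k L]
    (p i : ℕ) (x y : L) : L :=
  (((X : (Module.End k L)[X]) * C (LieAlgebra.ad k L x) + C (LieAlgebra.ad k L y)) ^ (p - 1)).coeff
    (i - 1) x

/-- `Λ_p(x, y) = ∑_{i=1}^{p-1} s_i(x, y) / i`. -/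
def jacobsonLambda (k : Type*) {L : Type*} [Field k] [LieRing L] [LieAlgebra k L]
    (p : ℕ) (x y : L) : L :=
  ∑ i ∈ Finset.Icc 1 (p - 1), (i : k)⁻¹ • jacobsonCoeff k p i x y

/-- `f : L → L` is a `p`-map, i.e. `(L, f)` is a restricted Lie algebra over `k`
(to be used when `k` has characteristic `p > 0`). -/
structure IsRestrictedLie (k : Type*) {L : Type*} [Field k] [LieRing L] [LieAlgebra k L]
    (p : ℕ) (f : L → L) : Prop where
  ad_pow : ∀ x : L, LieAlgebra.ad k L x ^ p = LieAlgebra.ad k L (f x)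
  map_smul : ∀ (c : k) (x : L), f (c • x) = c ^ p • f x
  map_add : ∀ x y : L, f (x + y) = f x + f y + jacobsonLambda k p x y

end RestrictedLie

/-- A Poisson structure on a commutative `k`-algebra `A`: a Lie bracket on the `k`-module `A`
which satisfies the Leibniz rule. (It is a bundled bilinear map and not an instance of `Bracket`,
since Mathlib already equips the ring `A` with its commutator bracket.) -/
structure PoissonStructure (k A : Type*) [Field k] [CommRing A] [Algebra k A] where
  bracket : A →ₗ[k] A →ₗ[k] A
  bracket_self : ∀ x : A, bracket x x = 0
  jacobi : ∀ x y z : A,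
    bracket x (bracket y z) + bracket y (bracket z x) + bracket z (bracket x y) = 0
  leibniz : ∀ x y z : A, bracket (x * y) z = x * bracket y z + y * bracket x z

namespace PoissonStructure

variable {k A : Type*} [Field k] [CommRing A] [Algebra k A] (P : PoissonStructure k A)

theorem bracket_swap (x y : A) : P.bracket x y = -P.bracket y x := by
  have h := P.bracket_self (x + y)
  simp only [map_add, LinearMap.add_apply, P.bracket_self, zero_add, add_zero] at h
  exact eq_neg_of_add_eq_zero_right h

/-- The Lie ring `(A, {-, -})`. -/
abbrev toLieRing : LieRing A where
  bracket x y := P.bracket x y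
  add_lie x y z := by simp
  lie_add x y z := by simp
  lie_self x := P.bracket_self x
  leibniz_lie x y z := by
    change P.bracket x (P.bracket y z) = P.bracket (P.bracket x y) z + P.bracket y (P.bracket x z)
    have h := P.jacobi x y z
    rw [P.bracket_swap z (P.bracket x y), P.bracket_swap z x, map_neg] at h
    linear_combination h

/-- The Lie algebra `(A, {-, -})` over `k`. -/
abbrev toLieAlgebra : @LieAlgebra k A _ P.toLieRing :=
  letI := P.toLieRing
  { (inferInstance : Module k A) with
    lie_smul := fun c x y => (P.bracket x).map_smul c y }

/-- `Λ_p` for the Lie algebra `(A, {-, -})`. -/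
def Lambda (p : ℕ) (x y : A) : A :=
  letI := P.toLieRing
  letI := P.toLieAlgebra
  jacobsonLambda k p x y

/-- `Φ_p(x, y) = (x^p + y^p) Λ_p(x, y) - (Λ_p(x², y²) + Λ_p(x² + y², 2xy)) / 2`. -/
def Phi (p : ℕ) (x y : A) : A :=
  (x ^ p + y ^ p) * P.Lambda p x y
    - (2 : k)⁻¹ • (P.Lambda p (x ^ 2) (y ^ 2) + P.Lambda p (x ^ 2 + y ^ 2) (2 * x * y))

/-- `(A, ·, {-, -}, f)` is a weakly restricted Poisson algebra:
`(A, {-, -}, f)` is a restricted Lie algebra. -/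
def IsWeaklyRestricted (p : ℕ) (f : A → A) : Prop :=
  letI := P.toLieRing
  letI := P.toLieAlgebra
  IsRestrictedLie k p f

/-- `(A, ·, {-, -}, f)` is a restricted Poisson algebra: it is weakly restricted, and
`f (x²) = 2 x^p f x` for all `x`. -/
structure IsRestricted (p : ℕ) (f : A → A) : Prop where
  weaklyRestricted : P.IsWeaklyRestricted p f
  map_sq : ∀ x : A, f (x ^ 2) = 2 * x ^ p * f x

end PoissonStructure

end

/-! ### Lie derivations and the closed one-form `ad_w ^ (p - 1)`. -/

noncomputable section

namespace PoissonStructure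

variable {k A : Type*} [Field k] [CommRing A] [Algebra k A] (P : PoissonStructure k A)

/-! Let D(x, y) = f(xy) - x^p f(y) - y^p f(x) - Φ_p(x, y) be the defect of the product formula
(`mulDefect`). It is symmetric, additive and p-semilinear in y, so vanishing on pairs of basis
vectors forces D = 0. Since Φ_p(x, x) = 0, the equation D(x, x) = 0 is the restrictedness condition.

The substance is additivity. It amounts to an identity not involving f, valid in every Poisson
algebra in characteristic p ≥ 3: Λ_p(xy, xz) - x^p Λ_p(y, z) = Φ_p(x, y + z) - Φ_p(x, y) - Φ_p(x, z)
(`phiDefect_eq_zero`). For a Poisson derivation δ put ω(w) = ad_w^{p-1}(δ w), the formal derivative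
of the p-map along δ. Then δΛ_p(u, v) = ω(u + v) - ω(u) - ω(v) and δΦ_p(x, y) = ω(xy) - x^p ω(y) -
y^p ω(x), even when there is no p-map. Hence every derivation kills the difference of the two sides.

To conclude that the difference is zero, replace x, y, z by xX_0, yX_1, zX_2 with central variables
X_i. The three Euler derivations make all exponents divisible by p, and vanishing at X_i = 0 makes
them positive, so the total degree is at least 3p. But it is 2p, so nothing survives; then set X_i =
1. With two variables the same count leaves only X_0^p X_1^p in Φ_p, which gives semilinearity
(`Phi_smul_right`). -/

theorem bracket_leibniz_right (x y z : A) :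
    P.bracket x (y * z) = y * P.bracket x z + z * P.bracket x y := by
  rw [P.bracket_swap, P.leibniz, P.bracket_swap x z, P.bracket_swap x y]
  ring

theorem bracket_bracket (w x y : A) :
    P.bracket w (P.bracket x y) = P.bracket (P.bracket w x) y + P.bracket x (P.bracket w y) := by
  have h := P.jacobi w x y
  rw [P.bracket_swap y (P.bracket w x), P.bracket_swap y w, map_neg] at h
  linear_combination h

/-- A Lie derivation of the bracket of `P`. -/
def IsLieDerivation (δ : A →ₗ[k] A) : Prop :=
  ∀ x y, δ (P.bracket x y) = P.bracket (δ x) y + P.bracket x (δ y)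

/-- A Poisson derivation: a derivation of both the product and the bracket. -/
structure IsDerivation (δ : A →ₗ[k] A) : Prop where
  bracket : P.IsLieDerivation δ
  mul : ∀ x y, δ (x * y) = x * δ y + y * δ x

/-- The sum of `ad_w ^ i {u, ad_w ^ j v}` over `i + j = n - 1`, which measures how a derivation
sending `w` to `u` fails to commute with `ad_w ^ n`. -/
def adPowVariation (w u v : A) : ℕ → A
  | 0 => 0
  | n + 1 => P.bracket w (adPowVariation w u v n) + P.bracket u ((P.bracket w ^ n) v)

theorem IsLieDerivation.map_ad_pow {P : PoissonStructure k A} {δ : A →ₗ[k] A}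
    (hδ : P.IsLieDerivation δ) (w v : A) (n : ℕ) :
    δ ((P.bracket w ^ n) v) = (P.bracket w ^ n) (δ v) + P.adPowVariation w (δ w) v n := by
  induction n with
  | zero => simp [adPowVariation]
  | succ n ih =>
    simp only [pow_succ', Module.End.mul_apply, adPowVariation]
    rw [hδ, ih, map_add]
    abel

/-- Expanding each outer `ad_w` power by the Leibniz rule and collecting terms produces the binomial
coefficients, through Pascal's rule in the induction. -/
theorem adPowVariation_eq_sum (w u v : A) (n : ℕ) :
    P.adPowVariation w u v n = ∑ a ∈ Finset.range n,
      n.choose (a + 1) • P.bracket ((P.bracket w ^ a) u) ((P.bracket w ^ (n - 1 - a)) v) := by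
  induction n with
  | zero => simp [adPowVariation]
  | succ n ih =>
    have h1 : P.bracket w (P.adPowVariation w u v n) =
        (∑ a ∈ Finset.range n, n.choose (a + 1) •
          P.bracket ((P.bracket w ^ (a + 1)) u) ((P.bracket w ^ (n - (a + 1))) v)) +
        ∑ a ∈ Finset.range n, n.choose (a + 1) •
          P.bracket ((P.bracket w ^ a) u) ((P.bracket w ^ (n - a)) v) := by
      rw [ih, map_sum, ← Finset.sum_add_distrib]
      refine Finset.sum_congr rfl fun a ha => ?_
      rw [map_nsmul, bracket_bracket, ← smul_add]
      have h2 : n - a = (n - 1 - a) + 1 := by have := Finset.mem_range.1 ha; omega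
      have h3 : n - (a + 1) = n - 1 - a := by omega
      rw [h2, h3, pow_succ' _ a, pow_succ' _ (n - 1 - a)]
      rfl
    -- The extra term a = n is free, because `n.choose (n + 1) = 0`.
    have h4 : ∑ a ∈ Finset.range n, n.choose (a + 1) •
          P.bracket ((P.bracket w ^ a) u) ((P.bracket w ^ (n - a)) v) =
        ∑ a ∈ Finset.range (n + 1), n.choose (a + 1) •
          P.bracket ((P.bracket w ^ a) u) ((P.bracket w ^ (n - a)) v) := by
      rw [Finset.sum_range_succ]; simp
    have h5 : (∑ a ∈ Finset.range n, n.choose (a + 1) •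
          P.bracket ((P.bracket w ^ (a + 1)) u) ((P.bracket w ^ (n - (a + 1))) v)) +
          P.bracket u ((P.bracket w ^ n) v) =
        ∑ a ∈ Finset.range (n + 1), n.choose a •
          P.bracket ((P.bracket w ^ a) u) ((P.bracket w ^ (n - a)) v) := by
      rw [Finset.sum_range_succ']; simp
    rw [adPowVariation, h1, h4, add_right_comm, h5, ← Finset.sum_add_distrib]
    refine Finset.sum_congr rfl fun a _ => ?_
    rw [← add_smul, ← Nat.choose_succ_succ]
    rfl

/-- Exchanging u and v reverses the sum and flips the sign of each bracket. The difference thus has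
coefficients C(p-1, a+1) + C(p-1, a) = C(p, a+1), which vanish in characteristic p. -/
theorem adPowVariation_symm (p : ℕ) [hp : Fact p.Prime] [CharP k p] (w u v : A) :
    P.adPowVariation w u v (p - 1) = P.adPowVariation w v u (p - 1) := by
  rw [← sub_eq_zero, adPowVariation_eq_sum, adPowVariation_eq_sum]
  rw [← Finset.sum_range_reflect (fun a => (p - 1).choose (a + 1) •
    P.bracket ((P.bracket w ^ a) v) ((P.bracket w ^ (p - 1 - 1 - a)) u)), ← Finset.sum_sub_distrib]
  refine Finset.sum_eq_zero fun a ha => ?_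
  have ha' := Finset.mem_range.1 ha
  have h1 : p - 1 - 1 - (p - 1 - 1 - a) = a := by omega
  have h2 : (p - 1).choose (p - 1 - 1 - a + 1) = (p - 1).choose a := by
    rw [← Nat.choose_symm (by omega : a ≤ p - 1)]; congr 1; omega
  rw [h1, h2, P.bracket_swap ((P.bracket w ^ (p - 1 - 1 - a)) v), smul_neg, sub_neg_eq_add,
    ← add_smul, add_comm, ← Nat.choose_succ_succ]
  have h3 : (p - 1).succ = p := by omega
  have h4 : ((p.choose a.succ : ℕ) : k) = 0 :=
    (CharP.cast_eq_zero_iff k p _).2 (hp.out.dvd_choose_self (by omega) (by omega))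
  rw [h3, ← Nat.cast_smul_eq_nsmul k, h4, zero_smul]

/-- The one-form `w ↦ ad_w ^ (p - 1)` is closed in characteristic `p`. -/
theorem IsLieDerivation.ad_pow_comm {P : PoissonStructure k A} (p : ℕ) [Fact p.Prime] [CharP k p]
    {δ ε : A →ₗ[k] A} (hδ : P.IsLieDerivation δ) (hε : P.IsLieDerivation ε) (w : A)
    (hc : δ (ε w) = ε (δ w)) :
    δ ((P.bracket w ^ (p - 1)) (ε w)) = ε ((P.bracket w ^ (p - 1)) (δ w)) := by
  rw [hδ.map_ad_pow, hε.map_ad_pow, hc, P.adPowVariation_symm p]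

/-- A homomorphism of Poisson algebras. -/
structure IsHom {B : Type*} [CommRing B] [Algebra k B] (Q : PoissonStructure k B)
    (φ : A →ₐ[k] B) : Prop where
  map_bracket : ∀ x y, φ (P.bracket x y) = Q.bracket (φ x) (φ y)

/-! ### Coefficients of the pencil t ad_u + ad_v, and naturality of Λ_p and Φ_p. -/

/-- The polynomial `(t ad_u + ad_v) ^ n`. -/
def adPencil (u v : A) (n : ℕ) : (Module.End k A)[X] :=
  (X * C (P.bracket u) + C (P.bracket v)) ^ n

theorem Lambda_eq (p : ℕ) (u v : A) :
    P.Lambda p u v =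
      ∑ i ∈ Finset.Icc 1 (p - 1), (i : k)⁻¹ • (P.adPencil u v (p - 1)).coeff (i - 1) u :=
  rfl

theorem adPencil_zero (u v : A) : P.adPencil u v 0 = 1 := pow_zero _

theorem adPencil_succ_coeff_zero (u v a : A) (n : ℕ) :
    (P.adPencil u v (n + 1)).coeff 0 a = P.bracket v ((P.adPencil u v n).coeff 0 a) := by
  simp [adPencil, pow_succ', add_mul, mul_assoc]

theorem adPencil_succ_coeff_succ (u v a : A) (n i : ℕ) :
    (P.adPencil u v (n + 1)).coeff (i + 1) a =
      P.bracket u ((P.adPencil u v n).coeff i a) +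
        P.bracket v ((P.adPencil u v n).coeff (i + 1) a) := by
  simp [adPencil, pow_succ', add_mul, mul_assoc]

theorem adPencil_coeff_of_lt (u v a : A) {n i : ℕ} (h : n < i) :
    (P.adPencil u v n).coeff i a = 0 := by
  induction n generalizing i with
  | zero => simp [adPencil_zero, Polynomial.coeff_one, h.ne']
  | succ n ih =>
    obtain ⟨i, rfl⟩ : ∃ j, i = j + 1 := ⟨i - 1, by omega⟩
    simp [adPencil_succ_coeff_succ, ih (by omega : n < i), ih (by omega : n < i + 1)]

theorem adPencil_coeff_zero (u v a : A) (n : ℕ) :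
    (P.adPencil u v n).coeff 0 a = (P.bracket v ^ n) a := by
  induction n with
  | zero => simp [adPencil_zero]
  | succ n ih => rw [adPencil_succ_coeff_zero, ih, pow_succ', Module.End.mul_apply]

theorem adPencil_coeff_self (u v a : A) (n : ℕ) :
    (P.adPencil u v n).coeff n a = (P.bracket u ^ n) a := by
  induction n with
  | zero => simp [adPencil_zero]
  | succ n ih =>
    rw [adPencil_succ_coeff_succ, ih, adPencil_coeff_of_lt _ _ _ _ n.lt_succ_self, map_zero,
      add_zero, pow_succ', Module.End.mul_apply]

theorem sum_adPencil_coeff (u v a : A) (n : ℕ) :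
    ∑ i ∈ Finset.range (n + 1), (P.adPencil u v n).coeff i a = (P.bracket (u + v) ^ n) a := by
  induction n with
  | zero => simp [adPencil_zero]
  | succ n ih =>
    rw [Finset.sum_range_succ', pow_succ', Module.End.mul_apply, ← ih, map_add,
      LinearMap.add_apply, map_sum, map_sum, adPencil_succ_coeff_zero]
    simp only [adPencil_succ_coeff_succ, Finset.sum_add_distrib]
    rw [Finset.sum_range_succ (fun i => P.bracket v ((P.adPencil u v n).coeff (i + 1) a)),
      Finset.sum_range_succ' (fun i => P.bracket v ((P.adPencil u v n).coeff i a)),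
      adPencil_coeff_of_lt _ _ _ _ n.lt_succ_self, map_zero, add_zero, add_assoc]

/-- The innermost factor already kills u, since both {u, u} and {v, u} vanish. -/
theorem adPencil_coeff_of_commute {u v : A} (h : P.bracket v u = 0) {n : ℕ} (hn : n ≠ 0) (i : ℕ) :
    (P.adPencil u v n).coeff i u = 0 := by
  obtain ⟨n, rfl⟩ := Nat.exists_eq_succ_of_ne_zero hn
  have : P.adPencil u v (n + 1) = P.adPencil u v n * (X * C (P.bracket u) + C (P.bracket v)) :=
    pow_succ _ _
  rw [Nat.succ_eq_add_one, this, X_mul_C, mul_add, ← mul_assoc]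
  cases i <;> simp [h, P.bracket_self]

theorem IsHom.map_adPencil_coeff {P : PoissonStructure k A} {B : Type*} [CommRing B] [Algebra k B]
    {Q : PoissonStructure k B} {φ : A →ₐ[k] B} (h : P.IsHom Q φ) (u v a : A) (n i : ℕ) :
    φ ((P.adPencil u v n).coeff i a) = (Q.adPencil (φ u) (φ v) n).coeff i (φ a) := by
  induction n generalizing i with
  | zero => by_cases hi : i = 0 <;> simp [adPencil_zero, Polynomial.coeff_one, hi]
  | succ n ih =>
    cases i with
    | zero => rw [adPencil_succ_coeff_zero, adPencil_succ_coeff_zero, h.map_bracket, ih]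
    | succ i =>
      rw [adPencil_succ_coeff_succ, adPencil_succ_coeff_succ, map_add, h.map_bracket,
        h.map_bracket, ih, ih]

theorem IsHom.map_Lambda {P : PoissonStructure k A} {B : Type*} [CommRing B] [Algebra k B]
    {Q : PoissonStructure k B} {φ : A →ₐ[k] B} (h : P.IsHom Q φ) (p : ℕ) (u v : A) :
    φ (P.Lambda p u v) = Q.Lambda p (φ u) (φ v) := by
  simp only [Lambda_eq, map_sum, map_smul, h.map_adPencil_coeff]

theorem IsHom.map_Phi {P : PoissonStructure k A} {B : Type*} [CommRing B] [Algebra k B]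
    {Q : PoissonStructure k B} {φ : A →ₐ[k] B} (h : P.IsHom Q φ) (p : ℕ) (u v : A) :
    φ (P.Phi p u v) = Q.Phi p (φ u) (φ v) := by
  simp only [Phi, map_sub, map_mul, map_add, map_pow, map_smul, h.map_Lambda, map_ofNat]

theorem Lambda_of_commute {p : ℕ} (hp : 3 ≤ p) {u v : A} (h : P.bracket v u = 0) :
    P.Lambda p u v = 0 := by
  rw [Lambda_eq]
  refine Finset.sum_eq_zero fun i _ => ?_
  rw [P.adPencil_coeff_of_commute h (by omega), smul_zero]

end PoissonStructure

end

/-! ### The Poisson algebra A[M]: derivations, characters and homogeneity. -/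

noncomputable section

namespace PoissonStructure

variable {k A M : Type*} [Field k] [CommRing A] [Algebra k A] (P : PoissonStructure k A)
  [AddCommMonoid M]

variable (M) in
/-- The extension of the bracket to the monoid algebra `A[M]`, with `M` central. -/
def monoidBracket : AddMonoidAlgebra A M →ₗ[k] AddMonoidAlgebra A M →ₗ[k] AddMonoidAlgebra A M :=
  LinearMap.mk₂ k
    (fun f g => f.coeff.sum fun m a => g.coeff.sum fun n b =>
      AddMonoidAlgebra.single (m + n) (P.bracket a b))
    (fun f₁ f₂ g => by
      rw [AddMonoidAlgebra.coeff_add, Finsupp.sum_add_index']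
      · simp
      · intros; simp [Finsupp.sum_add])
    (fun c f g => by
      rw [AddMonoidAlgebra.coeff_smul, Finsupp.sum_smul_index' (by simp)]
      simp [Finsupp.smul_sum, ← AddMonoidAlgebra.smul_single])
    (fun f g₁ g₂ => by
      rw [← Finsupp.sum_add]
      refine Finsupp.sum_congr fun m _ => ?_
      rw [AddMonoidAlgebra.coeff_add, Finsupp.sum_add_index'] <;> simp)
    (fun c f g => by
      rw [Finsupp.smul_sum]
      refine Finsupp.sum_congr fun m _ => ?_
      rw [AddMonoidAlgebra.coeff_smul, Finsupp.sum_smul_index' (by simp)]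
      simp [Finsupp.smul_sum, ← AddMonoidAlgebra.smul_single])

theorem monoidBracket_apply (f g : AddMonoidAlgebra A M) :
    P.monoidBracket M f g = f.coeff.sum fun m a => g.coeff.sum fun n b =>
      AddMonoidAlgebra.single (m + n) (P.bracket a b) :=
  rfl

theorem monoidBracket_single (m n : M) (a b : A) :
    P.monoidBracket M (AddMonoidAlgebra.single m a) (AddMonoidAlgebra.single n b) =
      AddMonoidAlgebra.single (m + n) (P.bracket a b) := by
  simp [monoidBracket_apply]

theorem monoidBracket_swap (f g : AddMonoidAlgebra A M) :
    P.monoidBracket M f g = -P.monoidBracket M g f := by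
  induction f using AddMonoidAlgebra.induction_linear with
  | zero => simp
  | add f₁ f₂ h₁ h₂ => simp only [map_add, LinearMap.add_apply, h₁, h₂, neg_add]
  | single m a =>
    induction g using AddMonoidAlgebra.induction_linear with
    | zero => simp
    | add g₁ g₂ h₁ h₂ => simp only [map_add, LinearMap.add_apply, h₁, h₂, neg_add]
    | single n b =>
      rw [monoidBracket_single, monoidBracket_single, P.bracket_swap, add_comm n m,
        AddMonoidAlgebra.single_neg]

variable (M) in
/-- The extension of a Poisson structure on `A` to the monoid algebra `A[M]`. -/
def monoid : PoissonStructure k (AddMonoidAlgebra A M) where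
  bracket := P.monoidBracket M
  bracket_self f := by
    induction f using AddMonoidAlgebra.induction_linear with
    | zero => simp
    | add f₁ f₂ h₁ h₂ =>
      simp only [map_add, LinearMap.add_apply, h₁, h₂]
      rw [P.monoidBracket_swap f₁ f₂]
      simp
    | single m a => rw [monoidBracket_single, P.bracket_self, AddMonoidAlgebra.single_zero]
  jacobi f g h := by
    induction f using AddMonoidAlgebra.induction_linear with
    | zero => simp
    | add f₁ f₂ h₁ h₂ =>
      simp only [map_add, LinearMap.add_apply]
      linear_combination h₁ + h₂
    | single m a =>
      induction g using AddMonoidAlgebra.induction_linear with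
      | zero => simp
      | add g₁ g₂ h₁ h₂ =>
        simp only [map_add, LinearMap.add_apply]
        linear_combination h₁ + h₂
      | single n b =>
        induction h using AddMonoidAlgebra.induction_linear with
        | zero => simp
        | add g₁ g₂ h₁ h₂ =>
          simp only [map_add, LinearMap.add_apply]
          linear_combination h₁ + h₂
        | single l c =>
          simp only [monoidBracket_single]
          rw [show n + (l + m) = m + (n + l) by abel, show l + (m + n) = m + (n + l) by abel,
            ← AddMonoidAlgebra.single_add, ← AddMonoidAlgebra.single_add, P.jacobi,
            AddMonoidAlgebra.single_zero]
  leibniz f g h := by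
    induction f using AddMonoidAlgebra.induction_linear with
    | zero => simp
    | add f₁ f₂ h₁ h₂ =>
      simp only [map_add, LinearMap.add_apply, add_mul, mul_add]
      linear_combination h₁ + h₂
    | single m a =>
      induction g using AddMonoidAlgebra.induction_linear with
      | zero => simp
      | add g₁ g₂ h₁ h₂ =>
        simp only [map_add, LinearMap.add_apply, add_mul, mul_add]
        linear_combination h₁ + h₂
      | single n b =>
        induction h using AddMonoidAlgebra.induction_linear with
        | zero => simp
        | add g₁ g₂ h₁ h₂ =>
          simp only [map_add, mul_add]
          linear_combination h₁ + h₂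
        | single l c =>
          simp only [monoidBracket_single, AddMonoidAlgebra.single_mul_single]
          rw [show n + (m + l) = m + n + l by abel, show m + (n + l) = m + n + l by abel,
            ← AddMonoidAlgebra.single_add, P.leibniz]

theorem monoid_bracket_single (m n : M) (a b : A) :
    (P.monoid M).bracket (AddMonoidAlgebra.single m a) (AddMonoidAlgebra.single n b) =
      AddMonoidAlgebra.single (m + n) (P.bracket a b) :=
  P.monoidBracket_single m n a b

/-- The linear endomorphism of `A[M]` acting by `δ m` on the coefficient of `m`. -/
def coeffwise (δ : M → A →ₗ[k] A) : AddMonoidAlgebra A M →ₗ[k] AddMonoidAlgebra A M :=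
  (Finsupp.lsum k fun m => AddMonoidAlgebra.lsingle m ∘ₗ δ m) ∘ₗ
    (AddMonoidAlgebra.coeffLinearEquiv k).toLinearMap

omit [AddCommMonoid M] in
@[simp]
theorem coeffwise_single (δ : M → A →ₗ[k] A) (m : M) (a : A) :
    coeffwise δ (AddMonoidAlgebra.single m a) = AddMonoidAlgebra.single m (δ m a) := by
  simp [coeffwise]

theorem coeff_coeffwise (δ : M → A →ₗ[k] A) (f : AddMonoidAlgebra A M) (m : M) :
    (coeffwise δ f).coeff m = δ m (f.coeff m) := by
  classical
  induction f using AddMonoidAlgebra.induction_linear with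
  | zero => simp
  | add f g hf hg => simp [hf, hg]
  | single n a =>
    simp only [coeffwise_single, AddMonoidAlgebra.coeff_single, Finsupp.single_apply]
    split_ifs with h
    · rw [h]
    · simp

/-- Letting δ depend on the exponent covers both the Euler derivations and the extension of a
derivation of A to its coefficients. -/
theorem isDerivation_coeffwise {δ : M → A →ₗ[k] A}
    (hb : ∀ m n a b, δ (m + n) (P.bracket a b) = P.bracket (δ m a) b + P.bracket a (δ n b))
    (hm : ∀ m n a b, δ (m + n) (a * b) = a * δ n b + b * δ m a) :
    (P.monoid M).IsDerivation (coeffwise δ) where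
  bracket f g := by
    induction f using AddMonoidAlgebra.induction_linear with
    | zero => simp
    | add f₁ f₂ h₁ h₂ =>
      simp only [map_add, LinearMap.add_apply, h₁, h₂]
      abel
    | single m a =>
      induction g using AddMonoidAlgebra.induction_linear with
      | zero => simp
      | add g₁ g₂ h₁ h₂ =>
        simp only [map_add, h₁, h₂]
        abel
      | single n b =>
        simp only [monoid_bracket_single, coeffwise_single, hb, AddMonoidAlgebra.single_add]
  mul f g := by
    induction f using AddMonoidAlgebra.induction_linear with
    | zero => simp
    | add f₁ f₂ h₁ h₂ =>
      simp only [map_add, add_mul, mul_add, h₁, h₂]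
      abel
    | single m a =>
      induction g using AddMonoidAlgebra.induction_linear with
      | zero => simp
      | add g₁ g₂ h₁ h₂ =>
        simp only [map_add, add_mul, mul_add, h₁, h₂]
        abel
      | single n b =>
        simp only [AddMonoidAlgebra.single_mul_single, coeffwise_single, hm,
          AddMonoidAlgebra.single_add, add_comm n m]

/-- The Euler derivation of `A[M]` attached to a weight `w : M →+ ℕ`. -/
def euler (k A : Type*) {M : Type*} [Field k] [CommRing A] [Algebra k A] [AddCommMonoid M]
    (w : M →+ ℕ) : AddMonoidAlgebra A M →ₗ[k] AddMonoidAlgebra A M :=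
  coeffwise fun m => (w m : k) • LinearMap.id

theorem coeff_euler (w : M →+ ℕ) (f : AddMonoidAlgebra A M) (m : M) :
    (euler k A w f).coeff m = (w m : k) • f.coeff m := by
  simp [euler, coeff_coeffwise]

theorem euler_single (w : M →+ ℕ) (m : M) (a : A) :
    euler k A w (AddMonoidAlgebra.single m a) = AddMonoidAlgebra.single m ((w m : k) • a) := by
  simp [euler]

theorem isDerivation_euler (w : M →+ ℕ) : (P.monoid M).IsDerivation (euler k A w) := by
  refine P.isDerivation_coeffwise (fun m n a b => ?_) (fun m n a b => ?_)
  · simp [add_smul]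
  · simp [add_smul, mul_comm b a, add_comm]

theorem isDerivation_coeffwise_const {δ : A →ₗ[k] A} (hδ : P.IsDerivation δ) :
    (P.monoid M).IsDerivation (coeffwise fun _ => δ) :=
  P.isDerivation_coeffwise (fun _ _ => hδ.bracket) (fun _ _ => hδ.mul)

/-- The endomorphism of `A[M]` rescaling each `m : M` by a character `χ m`. -/
def twist (A : Type*) {k M : Type*} [Field k] [CommRing A] [Algebra k A] [AddCommMonoid M]
    (χ : Multiplicative M →* k) : AddMonoidAlgebra A M →ₐ[k] AddMonoidAlgebra A M :=
  AlgHom.ofLinearMap (coeffwise fun m => χ (Multiplicative.ofAdd m) • LinearMap.id)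
    (by rw [AddMonoidAlgebra.one_def]; simp)
    (fun f g => by
      induction f using AddMonoidAlgebra.induction_linear with
      | zero => simp
      | add f₁ f₂ h₁ h₂ => simp only [map_add, add_mul, h₁, h₂]
      | single m a =>
        induction g using AddMonoidAlgebra.induction_linear with
        | zero => simp
        | add g₁ g₂ h₁ h₂ => simp only [map_add, mul_add, h₁, h₂]
        | single n b =>
          simp only [AddMonoidAlgebra.single_mul_single, coeffwise_single, ofAdd_add, map_mul,
            LinearMap.smul_apply, LinearMap.id_apply, smul_mul_smul_comm])

theorem coeff_twist (χ : Multiplicative M →* k) (f : AddMonoidAlgebra A M) (m : M) :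
    (twist A χ f).coeff m = χ (Multiplicative.ofAdd m) • f.coeff m :=
  coeff_coeffwise _ _ _

theorem twist_single (χ : Multiplicative M →* k) (m : M) (a : A) :
    twist A χ (AddMonoidAlgebra.single m a) =
      AddMonoidAlgebra.single m (χ (Multiplicative.ofAdd m) • a) :=
  coeffwise_single _ _ _

theorem isHom_of_single {B : Type*} [CommRing B] [Algebra k B] {Q : PoissonStructure k B}
    {φ : AddMonoidAlgebra A M →ₐ[k] B}
    (h : ∀ m n a b, φ (AddMonoidAlgebra.single (m + n) (P.bracket a b)) =
      Q.bracket (φ (AddMonoidAlgebra.single m a)) (φ (AddMonoidAlgebra.single n b))) :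
    (P.monoid M).IsHom Q φ where
  map_bracket f g := by
    induction f using AddMonoidAlgebra.induction_linear with
    | zero => simp
    | add f₁ f₂ h₁ h₂ => simp only [map_add, LinearMap.add_apply, h₁, h₂]
    | single m a =>
      induction g using AddMonoidAlgebra.induction_linear with
      | zero => simp
      | add g₁ g₂ h₁ h₂ => simp only [map_add, h₁, h₂]
      | single n b => rw [monoid_bracket_single, h]

theorem isHom_twist (χ : Multiplicative M →* k) :
    (P.monoid M).IsHom (P.monoid M) (twist A χ) := by
  refine P.isHom_of_single fun m n a b => ?_
  simp [twist_single, monoid_bracket_single, smul_smul, mul_comm]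

/-- The homomorphism `A[M] → A` sending each `m : M` to the scalar `χ m`. -/
def evalChar (A : Type*) {k M : Type*} [Field k] [CommRing A] [Algebra k A] [AddCommMonoid M]
    (χ : Multiplicative M →* k) : AddMonoidAlgebra A M →ₐ[k] A :=
  AddMonoidAlgebra.liftNCAlgHom (AlgHom.id k A) ((algebraMap k A : k →* A).comp χ)
    (fun _ _ => Commute.all _ _)

theorem evalChar_single (χ : Multiplicative M →* k) (m : M) (a : A) :
    evalChar A χ (AddMonoidAlgebra.single m a) = χ (Multiplicative.ofAdd m) • a := by
  simp [evalChar, Algebra.smul_def, mul_comm]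

theorem isHom_evalChar (χ : Multiplicative M →* k) :
    (P.monoid M).IsHom P (evalChar A χ) := by
  refine P.isHom_of_single fun m n a b => ?_
  simp [evalChar_single, smul_smul, mul_comm]

/-- The elements of `A[M]` homogeneous of degree `d` for the weight `w`. -/
abbrev homogeneous (A : Type*) {M : Type*} [CommRing A] [AddCommMonoid M] (w : M →+ ℕ) (d : ℕ) :
    Submodule A (AddMonoidAlgebra A M) :=
  AddMonoidAlgebra.gradeBy A w d

theorem monoid_bracket_mem_homogeneous {w : M →+ ℕ} {d e : ℕ} {f g : AddMonoidAlgebra A M}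
    (hf : f ∈ homogeneous A w d) (hg : g ∈ homogeneous A w e) :
    (P.monoid M).bracket f g ∈ homogeneous A w (d + e) := by
  refine Submodule.sum_mem _ fun m hm => Submodule.sum_mem _ fun n hn => ?_
  have := AddMonoidAlgebra.single_mem_gradeBy w (m + n) (P.bracket (f.coeff m) (g.coeff n))
  rwa [map_add, hf m hm, hg n hn] at this

theorem smul_mem_homogeneous {w : M →+ ℕ} {d : ℕ} {f : AddMonoidAlgebra A M}
    (hf : f ∈ homogeneous A w d) (c : k) : c • f ∈ homogeneous A w d := by
  rw [← algebraMap_smul A c f]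
  exact Submodule.smul_mem _ _ hf

theorem adPencil_coeff_mem_homogeneous {w : M →+ ℕ} {d e : ℕ} {u v a : AddMonoidAlgebra A M}
    (hu : u ∈ homogeneous A w d) (hv : v ∈ homogeneous A w d) (ha : a ∈ homogeneous A w e)
    (n i : ℕ) :
    ((P.monoid M).adPencil u v n).coeff i a ∈ homogeneous A w (n * d + e) := by
  induction n generalizing i with
  | zero =>
    rw [adPencil_zero, Polynomial.coeff_one]
    split_ifs
    · simpa using ha
    · exact Submodule.zero_mem _
  | succ n ih =>
    rw [show (n + 1) * d + e = d + (n * d + e) by ring]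
    cases i with
    | zero =>
      rw [adPencil_succ_coeff_zero]
      exact P.monoid_bracket_mem_homogeneous hv (ih 0)
    | succ i =>
      rw [adPencil_succ_coeff_succ]
      exact Submodule.add_mem _ (P.monoid_bracket_mem_homogeneous hu (ih i))
        (P.monoid_bracket_mem_homogeneous hv (ih (i + 1)))

theorem Lambda_mem_homogeneous {w : M →+ ℕ} {d p : ℕ} (hp : 1 ≤ p) {u v : AddMonoidAlgebra A M}
    (hu : u ∈ homogeneous A w d) (hv : v ∈ homogeneous A w d) :
    (P.monoid M).Lambda p u v ∈ homogeneous A w (p * d) := by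
  rw [Lambda_eq]
  refine Submodule.sum_mem _ fun i _ => smul_mem_homogeneous ?_ _
  have := P.adPencil_coeff_mem_homogeneous hu hv hu (p - 1) (i - 1)
  rwa [← Nat.succ_mul, Nat.succ_eq_add_one, Nat.sub_add_cancel hp] at this

theorem Phi_mem_homogeneous {w : M →+ ℕ} {d p : ℕ} (hp : 1 ≤ p) {u v : AddMonoidAlgebra A M}
    (hu : u ∈ homogeneous A w d) (hv : v ∈ homogeneous A w d) :
    (P.monoid M).Phi p u v ∈ homogeneous A w (2 * (p * d)) := by
  have pow_mem : ∀ {x : AddMonoidAlgebra A M} (n : ℕ), x ∈ homogeneous A w d →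
      x ^ n ∈ homogeneous A w (n * d) := fun n hx => SetLike.pow_mem_graded n hx
  have huv : 2 * u * v ∈ homogeneous A w (2 * d) := by
    have := SetLike.mul_mem_graded hu hv
    rw [mul_assoc, two_mul (u * v), two_mul d]
    exact Submodule.add_mem _ this this
  rw [Phi]
  refine Submodule.sub_mem _ ?_ (smul_mem_homogeneous ?_ _)
  · rw [two_mul]
    exact SetLike.mul_mem_graded (Submodule.add_mem _ (pow_mem p hu) (pow_mem p hv))
      (P.Lambda_mem_homogeneous hp hu hv)
  · rw [show 2 * (p * d) = p * (2 * d) by ring]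
    exact Submodule.add_mem _ (P.Lambda_mem_homogeneous hp (pow_mem 2 hu) (pow_mem 2 hv))
      (P.Lambda_mem_homogeneous hp
        (Submodule.add_mem _ (pow_mem 2 hu) (pow_mem 2 hv)) huv)

end PoissonStructure

end

/-! ### Derivatives of Λ_p and Φ_p along a Poisson derivation. -/

noncomputable section

namespace PoissonStructure

variable {k A : Type*} [Field k] [CommRing A] [Algebra k A] (P : PoissonStructure k A)

theorem coeff_monoid_bracket_single_add (m n : ℕ) (a : A) (f : AddMonoidAlgebra A ℕ) :
    ((P.monoid ℕ).bracket (AddMonoidAlgebra.single m a) f).coeff (m + n) =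
      P.bracket a (f.coeff n) := by
  induction f using AddMonoidAlgebra.induction_linear with
  | zero => simp
  | add f g hf hg => simp [hf, hg]
  | single l b =>
    rw [monoid_bracket_single]
    simp only [AddMonoidAlgebra.coeff_single, Finsupp.single_apply, Nat.add_left_cancel_iff]
    split_ifs <;> simp

theorem coeff_monoid_bracket_single_of_lt {m n : ℕ} (h : n < m) (a : A)
    (f : AddMonoidAlgebra A ℕ) :
    ((P.monoid ℕ).bracket (AddMonoidAlgebra.single m a) f).coeff n = 0 := by
  induction f using AddMonoidAlgebra.induction_linear with
  | zero => simp
  | add f g hf hg => simp [hf, hg]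
  | single l b =>
    rw [monoid_bracket_single, AddMonoidAlgebra.coeff_single, Finsupp.single_apply,
      if_neg (by omega)]

/-- In A[t], with t central, the pencil becomes the genuine adjoint of w = tu + v. The vanishing
below degree d is carried along because the induction step at i = 0 needs it. -/
theorem coeff_ad_pow_single (u v a : A) (n d i : ℕ) :
    (((P.monoid ℕ).bracket (AddMonoidAlgebra.single 1 u + AddMonoidAlgebra.single 0 v) ^ n)
      (AddMonoidAlgebra.single d a)).coeff (d + i) = (P.adPencil u v n).coeff i a ∧
    ∀ j < d, (((P.monoid ℕ).bracket (AddMonoidAlgebra.single 1 u + AddMonoidAlgebra.single 0 v) ^ n)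
      (AddMonoidAlgebra.single d a)).coeff j = 0 := by
  induction n generalizing i with
  | zero =>
    refine ⟨?_, fun j hj => ?_⟩
    · by_cases hi : i = 0 <;>
        simp [adPencil_zero, Polynomial.coeff_one, AddMonoidAlgebra.coeff_single, hi]
    · simp [AddMonoidAlgebra.coeff_single, hj.ne']
  | succ n ih =>
    have key0 : ∀ f : AddMonoidAlgebra A ℕ, ∀ j,
        ((P.monoid ℕ).bracket (AddMonoidAlgebra.single 0 v) f).coeff j =
          P.bracket v (f.coeff j) := fun f j => by
      simpa using P.coeff_monoid_bracket_single_add 0 j v f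
    have key1 : ∀ f : AddMonoidAlgebra A ℕ, ∀ j,
        ((P.monoid ℕ).bracket (AddMonoidAlgebra.single 1 u) f).coeff (j + 1) =
          P.bracket u (f.coeff j) := fun f j => by
      rw [add_comm j]; exact P.coeff_monoid_bracket_single_add 1 j u f
    have key2 : ∀ f : AddMonoidAlgebra A ℕ,
        ((P.monoid ℕ).bracket (AddMonoidAlgebra.single 1 u) f).coeff 0 = 0 := fun f =>
      P.coeff_monoid_bracket_single_of_lt Nat.one_pos u f
    have hlow := (ih 0).2
    have key : ∀ f : AddMonoidAlgebra A ℕ, ∀ j, ((P.monoid ℕ).bracket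
        (AddMonoidAlgebra.single 1 u + AddMonoidAlgebra.single 0 v) f).coeff j =
          ((P.monoid ℕ).bracket (AddMonoidAlgebra.single 1 u) f).coeff j +
            P.bracket v (f.coeff j) := fun f j => by
      rw [map_add, LinearMap.add_apply, AddMonoidAlgebra.coeff_add, Finsupp.add_apply, key0]
    rw [pow_succ', Module.End.mul_apply]
    simp only [key]
    refine ⟨?_, fun j hj => ?_⟩
    · cases i with
      | zero =>
        rw [adPencil_succ_coeff_zero, (ih 0).1]
        cases d with
        | zero => rw [key2, zero_add]
        | succ d =>
          rw [add_zero, key1, hlow d d.lt_succ_self, map_zero, zero_add]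
      | succ i => rw [← add_assoc, key1, (ih i).1, add_assoc, (ih (i + 1)).1,
          adPencil_succ_coeff_succ]
    · rw [hlow j hj, map_zero, add_zero]
      cases j with
      | zero => exact key2 _
      | succ j => rw [key1, hlow j (by omega), map_zero]

/-- Closedness of `ad_w ^ (p - 1)` in A[t] at w = tu + v, for δ and the Euler derivation t d/dt. The
latter sends w to tu, and comparing coefficients of t^{i+1} brings out the factor i + 1. -/
theorem IsDerivation.map_adPencil_coeff {P : PoissonStructure k A} (p : ℕ) [Fact p.Prime]
    [CharP k p] {δ : A →ₗ[k] A} (hδ : P.IsDerivation δ) (u v : A) (i : ℕ) :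
    δ ((P.adPencil u v (p - 1)).coeff i u) = ((i + 1 : ℕ) : k) •
      ((P.adPencil u v (p - 1)).coeff i (δ u) + (P.adPencil u v (p - 1)).coeff (i + 1) (δ v)) := by
  have h := (P.isDerivation_coeffwise_const (M := ℕ) hδ).bracket.ad_pow_comm p
    (P.isDerivation_euler (AddMonoidHom.id ℕ)).bracket
    (AddMonoidAlgebra.single 1 u + AddMonoidAlgebra.single 0 v) (by simp [euler_single])
  have h' := congrArg (fun f => f.coeff (1 + i)) h
  simp only [map_add, euler_single, coeffwise_single, coeff_coeffwise, coeff_euler,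
    AddMonoidHom.id_apply, Nat.cast_one, one_smul, Nat.cast_zero, zero_smul,
    AddMonoidAlgebra.single_zero, add_zero, AddMonoidAlgebra.coeff_add, Finsupp.add_apply] at h'
  rw [← map_add, (P.coeff_ad_pow_single u v u (p - 1) 1 i).1,
    (P.coeff_ad_pow_single u v (δ u) (p - 1) 1 i).1] at h'
  have h0 := (P.coeff_ad_pow_single u v (δ v) (p - 1) 0 (1 + i)).1
  rw [zero_add] at h0
  rw [h0] at h'
  rw [h', ← smul_add, add_comm 1 i]

theorem Lambda_eq_sum_range (p : ℕ) (u v : A) :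
    P.Lambda p u v = ∑ i ∈ Finset.range (p - 1),
      ((i + 1 : ℕ) : k)⁻¹ • (P.adPencil u v (p - 1)).coeff i u := by
  rw [Lambda_eq]
  refine Finset.sum_nbij' (fun i => i - 1) (fun i => i + 1) ?_ ?_ ?_ ?_ ?_
  · intro i hi; simp only [Finset.mem_Icc, Finset.mem_range] at *; omega
  · intro i hi; simp only [Finset.mem_Icc, Finset.mem_range] at *; omega
  · intro i hi; simp only [Finset.mem_Icc] at *; omega
  · intro i hi; simp
  · intro i hi
    rw [Nat.sub_add_cancel (Finset.mem_Icc.1 hi).1]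

/-- The one-form `w ↦ ad_w ^ (p - 1)` evaluated on the derivation `δ`; it is what the derivative
of `w ↦ w ^ {p}` along `δ` has to be. -/
def adForm (p : ℕ) (δ : A →ₗ[k] A) (w : A) : A :=
  (P.bracket w ^ (p - 1)) (δ w)

/-- The weights 1/i in Λ_p cancel the factors i coming from `map_adPencil_coeff`. What remains is
the full coefficient sum, ad_{u+v}^{p-1}, without its top term on δ u and without its bottom term on
δ v. -/
theorem IsDerivation.map_Lambda {P : PoissonStructure k A} (p : ℕ) [hp : Fact p.Prime]
    [CharP k p] {δ : A →ₗ[k] A} (hδ : P.IsDerivation δ) (u v : A) :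
    δ (P.Lambda p u v) = P.adForm p δ (u + v) - P.adForm p δ u - P.adForm p δ v := by
  have h1 : δ (P.Lambda p u v) = ∑ i ∈ Finset.range (p - 1),
      ((P.adPencil u v (p - 1)).coeff i (δ u) +
        (P.adPencil u v (p - 1)).coeff (i + 1) (δ v)) := by
    rw [Lambda_eq_sum_range, map_sum]
    refine Finset.sum_congr rfl fun i hi => ?_
    have hi' := Finset.mem_range.1 hi
    have h0 : ((i + 1 : ℕ) : k) ≠ 0 := fun h => by
      have := Nat.le_of_dvd (by omega) ((CharP.cast_eq_zero_iff k p _).1 h)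
      omega
    rw [map_smul, hδ.map_adPencil_coeff p, smul_smul, inv_mul_cancel₀ h0, one_smul]
  have h2 := P.sum_adPencil_coeff u v (δ u) (p - 1)
  have h3 := P.sum_adPencil_coeff u v (δ v) (p - 1)
  rw [Finset.sum_range_succ, adPencil_coeff_self] at h2
  rw [Finset.sum_range_succ', adPencil_coeff_zero] at h3
  rw [h1, Finset.sum_add_distrib, adForm, adForm, adForm, map_add δ, map_add, ← h2, ← h3]
  abel

/-! ### The form ω on squares, multiples and products. -/

theorem bracket_pow_self_mul (x z : A) (n : ℕ) :
    P.bracket x (x ^ n * z) = x ^ n * P.bracket x z := by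
  induction n with
  | zero => simp
  | succ n ih =>
    rw [pow_succ', mul_assoc, P.bracket_leibniz_right, P.bracket_self, ih]
    ring

theorem ad_pow_pow_self_mul (x z : A) (m n : ℕ) :
    (P.bracket x ^ m) (x ^ n * z) = x ^ n * (P.bracket x ^ m) z := by
  induction m with
  | zero => simp
  | succ m ih =>
    rw [pow_succ', Module.End.mul_apply, Module.End.mul_apply, ih, P.bracket_pow_self_mul]

theorem ad_sq_pow (x z : A) (n : ℕ) :
    (P.bracket (x ^ 2) ^ n) z = 2 ^ n * x ^ n * (P.bracket x ^ n) z := by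
  induction n with
  | zero => simp
  | succ n ih =>
    have h : P.bracket (x ^ 2) (2 ^ n * (x ^ n * (P.bracket x ^ n) z)) =
        2 * x * (2 ^ n * (x ^ n * P.bracket x ((P.bracket x ^ n) z))) := by
      have h2 : (2 ^ n : A) * (x ^ n * (P.bracket x ^ n) z) =
          (2 ^ n : k) • (x ^ n * (P.bracket x ^ n) z) := by
        rw [Algebra.smul_def, map_pow, map_ofNat]
      rw [sq, P.leibniz, h2, map_smul, P.bracket_pow_self_mul, Algebra.smul_def]
      simp only [map_pow, map_ofNat]
      ring
    rw [pow_succ', Module.End.mul_apply, ih, mul_assoc, h, pow_succ' (P.bracket x),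
      Module.End.mul_apply]
    ring

theorem two_pow_char (p : ℕ) [Fact p.Prime] [CharP k p] : (2 : k) ^ p = 2 := by
  have := add_pow_char (1 : k) 1 (p := p)
  rw [one_pow] at this
  norm_num at this
  exact this

variable (k) in
theorem two_pow_char_algebra (A : Type*) [CommRing A] [Algebra k A] (p : ℕ) [Fact p.Prime]
    [CharP k p] : (2 : A) ^ p = 2 := by
  rw [← map_ofNat (algebraMap k A) 2, ← map_pow, two_pow_char p]

variable (k) in
theorem add_pow_char_algebra (p : ℕ) [hp : Fact p.Prime] [CharP k p] (x y : A) :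
    (x + y) ^ p = x ^ p + y ^ p := by
  have h : (p : A) = 0 := by
    rw [← map_natCast (algebraMap k A), CharP.cast_eq_zero, map_zero]
  rw [add_pow_prime_eq hp.out, h]
  simp

theorem IsDerivation.map_pow_char {P : PoissonStructure k A} (p : ℕ) [CharP k p]
    {δ : A →ₗ[k] A} (hδ : P.IsDerivation δ) (x : A) : δ (x ^ p) = 0 := by
  have h1 : δ 1 = 0 := by
    have := hδ.mul 1 1
    simpa using this
  have h2 : ∀ n : ℕ, δ (x ^ n) = n * x ^ (n - 1) * δ x := by
    intro n
    induction n with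
    | zero => simpa using h1
    | succ n ih =>
      rw [pow_succ', hδ.mul, ih]
      cases n with
      | zero => simp
      | succ n => simp only [Nat.add_sub_cancel]; push_cast; ring
  have h : (p : A) = 0 := by
    rw [← map_natCast (algebraMap k A), CharP.cast_eq_zero, map_zero]
  rw [h2, h]
  simp

/-- Here ad_{x²} = 2x ad_x, and ad_x commutes with multiplication by x, so ω(x²) = (2x)^{p-1}
ad_x^{p-1}(2x δx) = 2^p x^p ω(x), with 2^p = 2. -/
theorem IsDerivation.adForm_sq {P : PoissonStructure k A} (p : ℕ) [hp : Fact p.Prime] [CharP k p]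
    {δ : A →ₗ[k] A} (hδ : P.IsDerivation δ) (x : A) :
    P.adForm p δ (x ^ 2) = 2 * x ^ p * P.adForm p δ x := by
  have h : δ (x ^ 2) = x ^ 1 * ((2 : k) • δ x) := by
    rw [sq, hδ.mul, Algebra.smul_def, map_ofNat]; ring
  have h2 := two_pow_char_algebra k A p
  obtain ⟨n, rfl⟩ : ∃ n, p = n + 1 := ⟨p - 1, by have := hp.out.pos; omega⟩
  simp only [adForm, Nat.add_sub_cancel] at *
  rw [ad_sq_pow, h, ad_pow_pow_self_mul, map_smul, Algebra.smul_def, map_ofNat]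
  linear_combination (x ^ n * x * (P.bracket x ^ n) (δ x)) * h2

theorem adForm_smul (p : ℕ) (hp : 1 ≤ p) (δ : A →ₗ[k] A) (c : k) (x : A) :
    P.adForm p δ (c • x) = c ^ p • P.adForm p δ x := by
  obtain ⟨n, rfl⟩ : ∃ n, p = n + 1 := ⟨p - 1, by omega⟩
  rw [adForm, adForm, Nat.add_sub_cancel, map_smul, map_smul, map_smul, _root_.smul_pow,
    LinearMap.smul_apply, smul_smul, pow_succ']

/-- The innermost bracket is c{x, x} = 0. This applies to monomials under Euler derivations. -/
theorem adForm_eq_zero {p : ℕ} (hp : 2 ≤ p) {δ : A →ₗ[k] A} {c : k} {x : A} (h : δ x = c • x) :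
    P.adForm p δ x = 0 := by
  obtain ⟨n, rfl⟩ : ∃ n, p = n + 2 := ⟨p - 2, by omega⟩
  simp [adForm, h, pow_succ, P.bracket_self]

theorem two_mul_mul_eq_smul (x y : A) : 2 * x * y = (2 : k) • (x * y) := by
  rw [Algebra.smul_def, map_ofNat, mul_assoc]

/-- Φ_p comes from polarizing the square rule: the two inner Λ_p telescope along x² + y² + 2xy = (x
+ y)², leaving only squares, handled by `adForm_sq`, and the term 2xy. -/
theorem IsDerivation.map_Phi {P : PoissonStructure k A} (p : ℕ) [hp : Fact p.Prime] [CharP k p]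
    (h2 : (2 : k) ≠ 0) {δ : A →ₗ[k] A} (hδ : P.IsDerivation δ) (x y : A) :
    δ (P.Phi p x y) = P.adForm p δ (x * y) - x ^ p * P.adForm p δ y - y ^ p * P.adForm p δ x := by
  have h3 : P.adForm p δ (2 * x * y) = 2 * P.adForm p δ (x * y) := by
    rw [two_mul_mul_eq_smul (k := k), adForm_smul _ _ hp.out.one_le, two_pow_char p,
      Algebra.smul_def, map_ofNat]
  have h4 : x ^ 2 + y ^ 2 + 2 * x * y = (x + y) ^ 2 := by ring
  have h5 : δ (P.Lambda p (x ^ 2) (y ^ 2) + P.Lambda p (x ^ 2 + y ^ 2) (2 * x * y)) =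
      (2 : k) • ((x + y) ^ p * P.adForm p δ (x + y) - x ^ p * P.adForm p δ x -
        y ^ p * P.adForm p δ y - P.adForm p δ (x * y)) := by
    rw [map_add, hδ.map_Lambda p, hδ.map_Lambda p, h4, h3, hδ.adForm_sq p, hδ.adForm_sq p,
      hδ.adForm_sq p, Algebra.smul_def, map_ofNat]
    ring
  rw [Phi, map_sub, hδ.mul, map_smul, h5, smul_smul, inv_mul_cancel₀ h2, one_smul, map_add,
    hδ.map_pow_char p, hδ.map_pow_char p, hδ.map_Lambda p, add_pow_char_algebra k]
  ring

/-- The failure of `f (x * y) = x ^ p * f y + y ^ p * f x + Φ_p(x, y)` to be stable under addition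
in `y`. -/
def phiDefect (p : ℕ) (x y z : A) : A :=
  P.Lambda p (x * y) (x * z) - x ^ p * P.Lambda p y z -
    (P.Phi p x (y + z) - P.Phi p x y - P.Phi p x z)

theorem IsDerivation.map_phiDefect {P : PoissonStructure k A} (p : ℕ) [hp : Fact p.Prime]
    [CharP k p] (h2 : (2 : k) ≠ 0) {δ : A →ₗ[k] A} (hδ : P.IsDerivation δ) (x y z : A) :
    δ (P.phiDefect p x y z) = 0 := by
  rw [phiDefect, map_sub, map_sub, map_sub, map_sub, hδ.mul, hδ.map_pow_char p, hδ.map_Lambda p,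
    hδ.map_Lambda p, hδ.map_Phi p h2, hδ.map_Phi p h2, hδ.map_Phi p h2, add_pow_char_algebra k,
    mul_add]
  ring

theorem IsHom.map_phiDefect {P : PoissonStructure k A} {B : Type*} [CommRing B] [Algebra k B]
    {Q : PoissonStructure k B} {φ : A →ₐ[k] B} (h : P.IsHom Q φ) (p : ℕ) (x y z : A) :
    φ (P.phiDefect p x y z) = Q.phiDefect p (φ x) (φ y) (φ z) := by
  simp only [phiDefect, map_sub, map_mul, map_add, map_pow, h.map_Lambda, h.map_Phi]

end PoissonStructure

end

/-! ### Degenerate values and the exponent count in several variables. -/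

noncomputable section

namespace PoissonStructure

variable {k A : Type*} [Field k] [CommRing A] [Algebra k A] (P : PoissonStructure k A)

theorem Lambda_zero_left {p : ℕ} (hp : 3 ≤ p) (x : A) : P.Lambda p 0 x = 0 :=
  P.Lambda_of_commute hp (by simp)

theorem Lambda_zero_right {p : ℕ} (hp : 3 ≤ p) (x : A) : P.Lambda p x 0 = 0 :=
  P.Lambda_of_commute hp (by simp)

theorem Phi_zero_left {p : ℕ} (hp : 3 ≤ p) (x : A) : P.Phi p 0 x = 0 := by
  simp [Phi, P.Lambda_zero_left hp, P.Lambda_zero_right hp]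

theorem Phi_zero_right {p : ℕ} (hp : 3 ≤ p) (x : A) : P.Phi p x 0 = 0 := by
  simp [Phi, P.Lambda_zero_right hp]

theorem Phi_self {p : ℕ} (hp : 3 ≤ p) (x : A) : P.Phi p x x = 0 := by
  have h : P.bracket (2 * x * x) (x ^ 2 + x ^ 2) = 0 := by
    have : 2 * x * x = x ^ 2 + x ^ 2 := by ring
    rw [this, P.bracket_self]
  rw [Phi, P.Lambda_of_commute hp (P.bracket_self _), P.Lambda_of_commute hp (P.bracket_self _),
    P.Lambda_of_commute hp h]
  simp

theorem phiDefect_zero_left {p : ℕ} (hp : 3 ≤ p) (y z : A) : P.phiDefect p 0 y z = 0 := by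
  simp [phiDefect, P.Phi_zero_left hp, P.Lambda_zero_left hp, zero_pow (by omega : p ≠ 0)]

theorem phiDefect_zero_middle {p : ℕ} (hp : 3 ≤ p) (x z : A) : P.phiDefect p x 0 z = 0 := by
  simp [phiDefect, P.Phi_zero_right hp, P.Lambda_zero_left hp]

theorem phiDefect_zero_right {p : ℕ} (hp : 3 ≤ p) (x y : A) : P.phiDefect p x y 0 = 0 := by
  simp [phiDefect, P.Phi_zero_right hp, P.Lambda_zero_right hp]

section MultiGraded

variable {ι : Type*} [Fintype ι]

/-- The character of `ι → ℕ` sending `m` to `∏ i, c i ^ m i`. -/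
def monomialChar (c : ι → k) : Multiplicative (ι → ℕ) →* k where
  toFun m := ∏ i, c i ^ Multiplicative.toAdd m i
  map_one' := by simp
  map_mul' m n := by simp [pow_add, Finset.prod_mul_distrib]

theorem monomialChar_ofAdd (c : ι → k) (m : ι → ℕ) :
    monomialChar c (Multiplicative.ofAdd m) = ∏ i, c i ^ m i :=
  rfl

/-- The total degree of an exponent. -/
def totalDegree (ι : Type*) [Fintype ι] : (ι → ℕ) →+ ℕ where
  toFun m := ∑ i, m i
  map_zero' := by simp
  map_add' m n := by simp [Finset.sum_add_distrib]

theorem totalDegree_apply (m : ι → ℕ) : totalDegree ι m = ∑ i, m i := rfl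

variable [DecidableEq ι]

/-- The monomial `a X_i`. -/
def var (i : ι) (a : A) : AddMonoidAlgebra A (ι → ℕ) :=
  AddMonoidAlgebra.single (Pi.single i 1) a

theorem evalChar_var (c : ι → k) (i : ι) (a : A) :
    evalChar A (monomialChar c) (var i a) = c i • a := by
  rw [var, evalChar_single, monomialChar_ofAdd, Finset.prod_eq_single i] <;>
    simp +contextual

theorem twist_var (c : ι → k) (i : ι) (a : A) :
    twist A (monomialChar c) (var i a) = var i (c i • a) := by
  rw [var, twist_single, monomialChar_ofAdd, Finset.prod_eq_single i] <;>
    simp +contextual [var]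

theorem twist_update_var_self (i : ι) (a : A) :
    twist A (monomialChar (Function.update (1 : ι → k) i 0)) (var i a) = 0 := by
  rw [twist_var, Function.update_self, zero_smul, var, AddMonoidAlgebra.single_zero]

omit [Fintype ι] in
theorem euler_var (i j : ι) (a : A) :
    euler k A (Pi.evalAddMonoidHom (fun _ : ι => ℕ) i) (var j a) =
      (if i = j then (1 : k) else 0) • var j a := by
  rw [var, euler_single, AddMonoidAlgebra.smul_single]
  by_cases h : i = j
  · subst h; simp
  · simp [h]

theorem var_mem_homogeneous (i : ι) (a : A) : var i a ∈ homogeneous A (totalDegree ι) 1 := by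
  have h := AddMonoidAlgebra.single_mem_gradeBy (totalDegree ι) (Pi.single i 1) a
  rwa [show totalDegree ι (Pi.single i 1) = 1 by simp [totalDegree_apply]] at h

/-- The i-th Euler derivation multiplies the coefficient at m by m i, so p divides m i. The twist by
`Function.update 1 i 0` sets X_i = 0 and fixes terms free of X_i, so m i is not 0. -/
theorem exponent_of_coeff_ne_zero {p d : ℕ} [CharP k p] {g : AddMonoidAlgebra A (ι → ℕ)}
    (hd : g ∈ homogeneous A (totalDegree ι) d)
    (he : ∀ i, euler k A (Pi.evalAddMonoidHom (fun _ : ι => ℕ) i) g = 0)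
    (ht : ∀ i, twist A (monomialChar (Function.update (1 : ι → k) i 0)) g = 0)
    {m : ι → ℕ} (hm : g.coeff m ≠ 0) :
    ∑ i, m i = d ∧ ∀ i, p ≤ m i := by
  refine ⟨hd m (by simpa using hm), fun i => ?_⟩
  have h1 : p ∣ m i := by
    have h := congrArg (fun f => f.coeff m) (he i)
    simp only [coeff_euler, AddMonoidAlgebra.coeff_zero, Finsupp.zero_apply] at h
    exact (CharP.cast_eq_zero_iff k p _).1 ((smul_eq_zero.1 h).resolve_right hm)
  refine Nat.le_of_dvd (Nat.pos_of_ne_zero fun h0 => hm ?_) h1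
  have h := congrArg (fun f => f.coeff m) (ht i)
  simp only [coeff_twist, AddMonoidAlgebra.coeff_zero, Finsupp.zero_apply,
    monomialChar_ofAdd] at h
  rw [Finset.prod_eq_one, one_smul] at h
  · exact h
  · intro j _
    by_cases hj : j = i
    · subst hj; simp [h0]
    · simp [hj]

end MultiGraded

theorem two_ne_zero_of_charP {p : ℕ} [CharP k p] (hp : 3 ≤ p) : (2 : k) ≠ 0 := fun h => by
  have := Nat.le_of_dvd two_pos ((CharP.cast_eq_zero_iff k p 2).1 (by exact_mod_cast h))
  omega

theorem phiDefect_mem_homogeneous {M : Type*} [AddCommMonoid M] {w : M →+ ℕ} {p : ℕ} (hp : 1 ≤ p)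
    {x y z : AddMonoidAlgebra A M} (hx : x ∈ homogeneous A w 1) (hy : y ∈ homogeneous A w 1)
    (hz : z ∈ homogeneous A w 1) :
    (P.monoid M).phiDefect p x y z ∈ homogeneous A w (2 * (p * 1)) := by
  have hxp : x ^ p ∈ homogeneous A w (p * 1) := SetLike.pow_mem_graded p hx
  refine Submodule.sub_mem _ (Submodule.sub_mem _ ?_ ?_) (Submodule.sub_mem _ (Submodule.sub_mem _
    (P.Phi_mem_homogeneous hp hx (Submodule.add_mem _ hy hz)) (P.Phi_mem_homogeneous hp hx hy))
    (P.Phi_mem_homogeneous hp hx hz))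
  · rw [show 2 * (p * 1) = p * (1 + 1) by ring]
    exact P.Lambda_mem_homogeneous hp (SetLike.mul_mem_graded hx hy) (SetLike.mul_mem_graded hx hz)
  · rw [two_mul]
    exact SetLike.mul_mem_graded hxp (P.Lambda_mem_homogeneous hp hy hz)

theorem phiDefect_eq_zero {p : ℕ} [hp' : Fact p.Prime] [CharP k p] (hp : 3 ≤ p) (x y z : A) :
    P.phiDefect p x y z = 0 := by
  have hg : (P.monoid (Fin 3 → ℕ)).phiDefect p (var 0 x) (var 1 y) (var 2 z) = 0 := by
    ext m
    rw [AddMonoidAlgebra.coeff_zero, Finsupp.zero_apply]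
    by_contra hm
    have h2 : (2 : k) ≠ 0 := two_ne_zero_of_charP hp
    obtain ⟨h1, h⟩ := exponent_of_coeff_ne_zero (k := k) (p := p)
      (P.phiDefect_mem_homogeneous (by omega) (var_mem_homogeneous 0 x) (var_mem_homogeneous 1 y)
        (var_mem_homogeneous 2 z))
      (fun i => (P.isDerivation_euler _).map_phiDefect p h2 _ _ _)
      (fun i => by
        rw [(P.isHom_twist _).map_phiDefect]
        fin_cases i
        · rw [Fin.zero_eta, twist_update_var_self, phiDefect_zero_left _ hp]
        · rw [Fin.mk_one, twist_update_var_self, phiDefect_zero_middle _ hp]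
        · rw [show (⟨2, by omega⟩ : Fin 3) = 2 from rfl, twist_update_var_self,
            phiDefect_zero_right _ hp]) hm
    -- Three exponents, each at least p, cannot add up to 2p.
    rw [Fin.sum_univ_three] at h1
    have := h 0
    have := h 1
    have := h 2
    omega
  -- Setting all variables to 1 returns to A.
  have h := congrArg (evalChar A (monomialChar (1 : Fin 3 → k))) hg
  rw [(P.isHom_evalChar _).map_phiDefect] at h
  simpa [evalChar_var] using h

/-- In two variables, exponents at least p with sum 2p must both equal p, so Φ_p(xX_0, yX_1) is a
multiple of X_0^p X_1^p and rescaling X_1 by c gives c^p. -/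
theorem Phi_smul_right {p : ℕ} [hp' : Fact p.Prime] [CharP k p] (hp : 3 ≤ p) (c : k) (x y : A) :
    P.Phi p x (c • y) = c ^ p • P.Phi p x y := by
  have h2 : (2 : k) ≠ 0 := two_ne_zero_of_charP hp
  let χ : Multiplicative (Fin 2 → ℕ) →* k := monomialChar ![1, c]
  -- Both arguments and their product are eigenvectors of the Euler derivations, so every ω in
  -- `map_Phi` vanishes.
  have he : ∀ i : Fin 2, euler k A (Pi.evalAddMonoidHom (fun _ : Fin 2 => ℕ) i)
      ((P.monoid (Fin 2 → ℕ)).Phi p (var 0 x) (var 1 y)) = 0 := fun i => by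
    have hd := P.isDerivation_euler (Pi.evalAddMonoidHom (fun _ : Fin 2 => ℕ) i)
    have h0 := euler_var (k := k) i 0 x
    have h1 := euler_var (k := k) i 1 y
    have h01 : euler k A (Pi.evalAddMonoidHom (fun _ : Fin 2 => ℕ) i) (var 0 x * var 1 y) =
        ((if i = 1 then (1 : k) else 0) + if i = 0 then (1 : k) else 0) •
          (var 0 x * var 1 y : AddMonoidAlgebra A (Fin 2 → ℕ)) := by
      rw [hd.mul, h0, h1, add_smul, mul_smul_comm, mul_smul_comm, mul_comm (var 1 y)]
    rw [hd.map_Phi p h2, adForm_eq_zero _ (by omega) h0, adForm_eq_zero _ (by omega) h1,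
      adForm_eq_zero _ (by omega) h01]
    simp
  have hg : twist A χ ((P.monoid (Fin 2 → ℕ)).Phi p (var 0 x) (var 1 y)) =
      c ^ p • (P.monoid (Fin 2 → ℕ)).Phi p (var 0 x) (var 1 y) := by
    ext m
    rw [coeff_twist, AddMonoidAlgebra.coeff_smul_apply]
    by_cases hm : ((P.monoid (Fin 2 → ℕ)).Phi p (var 0 x) (var 1 y)).coeff m = 0
    · rw [hm, smul_zero, smul_zero]
    obtain ⟨h1, h⟩ := exponent_of_coeff_ne_zero (k := k) (p := p)
      (P.Phi_mem_homogeneous (by omega) (var_mem_homogeneous 0 x) (var_mem_homogeneous 1 y)) he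
      (fun i => by
        rw [(P.isHom_twist _).map_Phi]
        fin_cases i
        · rw [Fin.zero_eta, twist_update_var_self, Phi_zero_left _ hp]
        · rw [Fin.mk_one, twist_update_var_self, Phi_zero_right _ hp]) hm
    rw [Fin.sum_univ_two] at h1
    have h3 : m 1 = p := by
      have := h 0
      have := h 1
      omega
    simp [χ, monomialChar_ofAdd, h3]
  have h := congrArg (evalChar A (monomialChar (1 : Fin 2 → k))) hg
  rw [(P.isHom_twist _).map_Phi, (P.isHom_evalChar _).map_Phi, map_smul,
    (P.isHom_evalChar _).map_Phi] at h
  simpa [χ, evalChar_var, twist_var] using h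

/-! ### The defect as a symmetric p-semilinear form. -/

/-- The failure of `f (x * y) = x ^ p * f y + y ^ p * f x + Φ_p(x, y)`. -/
def mulDefect (p : ℕ) (f : A → A) (x y : A) : A :=
  f (x * y) - x ^ p * f y - y ^ p * f x - P.Phi p x y

variable {P} {p : ℕ} {f : A → A}

theorem IsWeaklyRestricted.map_add (hf : P.IsWeaklyRestricted p f) (x y : A) :
    f (x + y) = f x + f y + P.Lambda p x y :=
  letI := P.toLieRing
  letI := P.toLieAlgebra
  IsRestrictedLie.map_add hf x y

theorem IsWeaklyRestricted.map_smul (hf : P.IsWeaklyRestricted p f) (c : k) (x : A) :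
    f (c • x) = c ^ p • f x :=
  letI := P.toLieRing
  letI := P.toLieAlgebra
  IsRestrictedLie.map_smul hf c x

/-- Compare the two expansions of f(x + y) = f(y + x). -/
theorem IsWeaklyRestricted.Lambda_comm (hf : P.IsWeaklyRestricted p f) (x y : A) :
    P.Lambda p x y = P.Lambda p y x := by
  have h := hf.map_add x y
  rw [add_comm x, hf.map_add y x] at h
  linear_combination -h

theorem IsWeaklyRestricted.mulDefect_comm (hf : P.IsWeaklyRestricted p f) (x y : A) :
    P.mulDefect p f x y = P.mulDefect p f y x := by
  have h : P.Phi p x y = P.Phi p y x := by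
    rw [Phi, Phi, hf.Lambda_comm x y, hf.Lambda_comm (x ^ 2), add_comm (x ^ p),
      add_comm (x ^ 2), mul_right_comm]
  rw [mulDefect, mulDefect, h, mul_comm x y]
  ring

/-- After expanding f on sums, all values of f cancel and exactly `phiDefect` remains. -/
theorem IsWeaklyRestricted.mulDefect_add [Fact p.Prime] [CharP k p] (hp : 3 ≤ p)
    (hf : P.IsWeaklyRestricted p f) (x y z : A) :
    P.mulDefect p f x (y + z) = P.mulDefect p f x y + P.mulDefect p f x z := by
  have h := P.phiDefect_eq_zero hp x y z
  rw [phiDefect] at h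
  rw [mulDefect, mulDefect, mulDefect, mul_add, hf.map_add, hf.map_add, add_pow_char_algebra k]
  linear_combination h

theorem IsWeaklyRestricted.mulDefect_smul [Fact p.Prime] [CharP k p] (hp : 3 ≤ p)
    (hf : P.IsWeaklyRestricted p f) (c : k) (x y : A) :
    P.mulDefect p f x (c • y) = c ^ p • P.mulDefect p f x y := by
  rw [mulDefect, mulDefect, mul_smul_comm, hf.map_smul, hf.map_smul, P.Phi_smul_right hp,
    _root_.smul_pow, mul_smul_comm, smul_mul_assoc, smul_sub, smul_sub, smul_sub]

theorem IsWeaklyRestricted.mulDefect_eq_zero_of_basis [Fact p.Prime] [CharP k p] (hp : 3 ≤ p)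
    (hf : P.IsWeaklyRestricted p f) {ι : Type*} (b : Module.Basis ι k A) {x : A}
    (h : ∀ i, P.mulDefect p f x (b i) = 0) (y : A) : P.mulDefect p f x y = 0 := by
  induction b.mem_span y using Submodule.span_induction with
  | mem y hy =>
    obtain ⟨i, rfl⟩ := hy
    exact h i
  | zero =>
    have := hf.mulDefect_smul hp 0 x 0
    rwa [zero_pow (by omega), zero_smul, zero_smul] at this
  | add y z _ _ hy hz => rw [hf.mulDefect_add hp, hy, hz, add_zero]
  | smul c y _ hy => rw [hf.mulDefect_smul hp, hy, smul_zero]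

end PoissonStructure

end

theorem theorem4p7 {k A ι : Type*} [Field k] (p : ℕ) [CharP k p] (hp : 3 ≤ p)
    [CommRing A] [Algebra k A] (P : PoissonStructure k A) (f : A → A)
    (hf : P.IsWeaklyRestricted p f) (b : Module.Basis ι k A)
    (hb : ∀ i j : ι,
      f (b i * b j) = b i ^ p * f (b j) + b j ^ p * f (b i) + P.Phi p (b i) (b j)) :
    P.IsRestricted p f := by
  have : Fact p.Prime := ⟨CharP.char_is_prime_of_two_le k p (by omega)⟩
  refine ⟨hf, fun x => ?_⟩
  -- Extend from the basis one argument at a time; symmetry of the defect allows the second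
  -- extension.
  have h1 : ∀ i y, P.mulDefect p f (b i) y = 0 := fun i y =>
    hf.mulDefect_eq_zero_of_basis hp b (fun j => by
      rw [PoissonStructure.mulDefect, hb]
      ring) y
  have h2 : P.mulDefect p f x x = 0 :=
    hf.mulDefect_eq_zero_of_basis hp b (fun i => by rw [hf.mulDefect_comm, h1]) x
  rw [PoissonStructure.mulDefect, P.Phi_self hp] at h2
  rw [sq]
  linear_combination h2
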